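/- A binary necklace is an equivalence class of words over $\{0,1\}$ under cyclic rotation. A binary de Bruijn word of order $m$ is a binary necklace of length $2^m$ that contains each of the $2^m$ binary words of length $m$ exactly once as a circular factor. A normal basis of $\mathrm{GF}(2^n)$ is a basis of $\mathrm{GF}(2^n)$ over $\mathrm{GF}(2)$ of the form $\{\gamma,\gamma^{2},\gamma^{2^2},\ldots,\gamma^{2^{n-1}}\}$ with $\gamma\in\mathrm{GF}(2^n)$; it is unordered if it is regarded as a set. Theorem. For every integer $d\ge 1$, the following three sets are pairwise in bijection: 1. the set of binary de Bruijn words of order $d+1$; 2. the set of binary necklaces of length $2^d$ having an odd number of $1$'s; 3. the set of unordered normal bases of $\mathrm{GF}(2^{2^d})$. -/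

import Mathlib

namespace DeBruijnNecklace

/-- Number of occurrences of the word `u` as a circular factor of the necklace `c`, where `u` is
not longer than `c`. The multiset `c.lists` holds the rotations of `c`, one for each starting
position, and `u` occurs at a position when it is a prefix of the rotation that starts there. -/
def occurrences {k : ℕ} (c : Cycle (Fin k)) (u : List (Fin k)) : ℕ :=
  c.lists.countP fun v => u <+: v

/-- A de Bruijn word of order `d` over `{0, …, k - 1}`: a necklace of length `k ^ d` that contains
each word of length `d` exactly once as a circular factor. -/
structure IsDeBruijnWord (k d : ℕ) (c : Cycle (Fin k)) : Prop where
  length_eq : c.length = k ^ d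
  occurs_once : ∀ u : List (Fin k), u.length = d → occurrences c u = 1

/-- The set of binary de Bruijn words of order `d`. -/
def binaryDeBruijnWords (d : ℕ) : Set (Cycle (Fin 2)) :=
  {c | IsDeBruijnWord 2 d c}

/-- The set of binary necklaces of length `n` with an odd number of letters `1`. -/
def oddBinaryNecklaces (n : ℕ) : Set (Cycle (Fin 2)) :=
  {c | c.length = n ∧ Odd (c.toMultiset.count 1)}

/-- `S` is the underlying set of a normal basis `γ, γ ^ p, …, γ ^ p ^ (n - 1)` of the field with
`p ^ n` elements over its prime field. -/
def IsNormalBasis (p n : ℕ) [Fact p.Prime] (S : Set (GaloisField p n)) : Prop :=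
  ∃ (γ : GaloisField p n) (b : Module.Basis (Fin n) (ZMod p) (GaloisField p n)),
    (∀ i : Fin n, b i = γ ^ p ^ (i : ℕ)) ∧ Set.range b = S

/-- The set of unordered normal bases of the field with `p ^ n` elements. -/
def normalBases (p n : ℕ) [Fact p.Prime] : Set (Set (GaloisField p n)) :=
  {S | IsNormalBasis p n S}

end DeBruijnNecklace

/-! All three sets have 2^(2^d - 1 - d) elements, and finite sets of equal size are in bijection; no
explicit bijection is built.

De Bruijn words with a marked start correspond to pairs of an initial state and a shift register,
with feedback f, whose state permutation P_f is a single cycle. To count such f, sum det(1 - X P_f)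
over all f. The rows of P_f at 0v and 1v have a sum independent of f, so the mean of the
determinants is the determinant of the mean (`det_average_eq`), namely det(1 - X W) with W the
random walk matrix; this equals 1 - X (`det_one_sub_walkMatrix`). Now differentiate at X = 1: a
single cycle contributes -2^(d+1), and any other permutation contributes 0 because 1 is a multiple
root.

A word of length 2^d with odd weight has no rotational symmetry, since a symmetry would make it a
square. So the 2^(2^d - 1) odd words form classes of size 2^d.

With n = 2^d, X^n - 1 = (X - 1)^n over GF(2), so γ is normal iff (φ - 1)^(n-1) γ = Tr γ is nonzero,
φ being Frobenius (`isNormalElement_iff`). Half of the field qualifies, and each normal basis has n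
generators. -/

namespace DeBruijnNecklace

open Polynomial

/-! ### Averaging determinants over paired rows. -/

section Averaging

variable {V R : Type*} [Fintype V] [DecidableEq V] [CommRing R]

/-- Adding the first block of rows to the second does not change the determinant. -/
theorem det_sumElim_add (A B : V → V ⊕ V → R) :
    Matrix.det (Matrix.of (Sum.elim A B)) = Matrix.det (Matrix.of (Sum.elim A (A + B))) := by
  have h : Matrix.of (Sum.elim A (A + B)) =
      Matrix.fromBlocks (1 : Matrix V V R) 0 1 1 * Matrix.of (Sum.elim A B) := by
    ext i j
    rcases i with i | i <;>
      simp [Matrix.mul_apply, Fintype.sum_sum_type, Matrix.one_apply]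
  rw [h, Matrix.det_mul, Matrix.det_fromBlocks_zero₁₂]
  simp

/-- If at every `v` the two rows `O v 0`, `O v 1` are attached in one of the two possible ways to
the rows `E₀ v`, `E₁ v`, then the mean of the determinants is the determinant of the mean. -/
theorem det_average_eq (E₀ E₁ : V → V ⊕ V → R) (O : V → Fin 2 → V ⊕ V → R) (c : R)
    (hc : 2 * c = 1) :
    Matrix.det (Matrix.of (Sum.elim (fun v => E₀ v - c • (O v 0 + O v 1))
      (fun v => E₁ v - c • (O v 0 + O v 1)))) =
    c ^ Fintype.card V * ∑ f : V → Fin 2, Matrix.det (Matrix.of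
      (Sum.elim (fun v => E₀ v - O v (f v)) (fun v => E₁ v - O v (f v + 1)))) := by
  have hsum : ∀ (v : V) (b : Fin 2), O v b + O v (b + 1) = O v 0 + O v 1 := by
    intro v b
    fin_cases b
    · rfl
    · exact add_comm _ _
  have hc' : c + c = 1 := by rw [← two_mul, hc]
  -- The sum of the two rows at v does not see the choice f v. With it as second block, each f v
  -- affects only one row.
  let S : V → V ⊕ V → R := fun v => E₀ v + E₁ v - (O v 0 + O v 1)
  have h1 : ∀ f : V → Fin 2, Matrix.det (Matrix.of
      (Sum.elim (fun v => E₀ v - O v (f v)) (fun v => E₁ v - O v (f v + 1)))) =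
      Matrix.det (Matrix.of (Sum.elim (fun v => E₀ v - O v (f v)) S)) := by
    intro f
    rw [det_sumElim_add]
    congr 3
    ext v j
    have := congrFun (hsum v (f v)) j
    simp only [Pi.add_apply, Pi.sub_apply, S] at this ⊢
    linear_combination -this
  -- Every row is split into two summands, trivially in the second block, so that multilinearity
  -- applies uniformly; the idle choices there give a factor 2^|V|, cancelled by c^|V|.
  let g : V ⊕ V → Fin 2 → V ⊕ V → R :=
    Sum.elim (fun v b => c • (E₀ v - O v b)) (fun v _ => c • S v)
  have h2 : Matrix.det (Matrix.of (Sum.elim (fun v => E₀ v - c • (O v 0 + O v 1))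
      (fun v => E₁ v - c • (O v 0 + O v 1)))) =
      Matrix.detRowAlternating.toMultilinearMap (fun i => ∑ j, g i j) := by
    rw [det_sumElim_add]
    change Matrix.det _ = Matrix.det _
    congr 1
    ext i j
    rcases i with v | v
    · simp only [Matrix.of_apply, Sum.elim_inl, Fin.sum_univ_two, g, Pi.add_apply, Pi.sub_apply,
        Pi.smul_apply, smul_eq_mul]
      linear_combination -(E₀ v j) * hc'
    · simp only [Matrix.of_apply, Sum.elim_inr, Fin.sum_univ_two, g, S, Pi.add_apply, Pi.sub_apply,
        Pi.smul_apply, smul_eq_mul]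
      linear_combination (-(E₀ v j) - E₁ v j) * hc'
  have h3 : ∀ r s : V → Fin 2, Matrix.detRowAlternating.toMultilinearMap
      (fun i => g i (Sum.elim r s i)) = c ^ Fintype.card V * c ^ Fintype.card V *
      Matrix.det (Matrix.of (Sum.elim (fun v => E₀ v - O v (r v)) S)) := by
    intro r s
    have : (fun i => g i (Sum.elim r s i)) =
        fun i => (fun _ => c) i • (Sum.elim (fun v => E₀ v - O v (r v)) S) i := by
      ext i j
      rcases i with v | v <;> rfl
    rw [this, MultilinearMap.map_smul_univ]
    simp only [Finset.prod_const, Finset.card_univ, Fintype.card_sum, pow_add, smul_eq_mul]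
    rfl
  rw [h2, MultilinearMap.map_sum,
    ← (Equiv.sumArrowEquivProdArrow V V (Fin 2)).symm.sum_comp, Fintype.sum_prod_type,
    Finset.mul_sum]
  refine Finset.sum_congr rfl fun f _ => ?_
  have h4 : ∀ s : V → Fin 2, Matrix.detRowAlternating.toMultilinearMap
      (fun i => g i ((Equiv.sumArrowEquivProdArrow V V (Fin 2)).symm (f, s) i)) =
      c ^ Fintype.card V * c ^ Fintype.card V *
      Matrix.det (Matrix.of (Sum.elim (fun v => E₀ v - O v (f v)) S)) := fun s => h3 f s
  simp only [h4, Finset.sum_const, Finset.card_univ, Fintype.card_fun, Fintype.card_fin,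
    nsmul_eq_mul, h1]
  push_cast
  have : (2 : R) ^ Fintype.card V * c ^ Fintype.card V = 1 := by
    rw [← mul_pow, hc, one_pow]
  linear_combination (c ^ Fintype.card V * Matrix.det (Matrix.of
    (Sum.elim (fun v => E₀ v - O v (f v)) S))) * this

end Averaging

/-! ### Detecting single cycles by the determinant of 1 - XP. -/

section PermutationMatrix

variable {ι : Type*} [Fintype ι] [DecidableEq ι]

/-- The matrix `1 - X P`, where `P` is the permutation matrix of `σ`. -/
noncomputable def oneSubXPerm (σ : Equiv.Perm ι) : Matrix ι ι ℚ[X] :=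
  Matrix.of fun i j => (if j = i then 1 else 0) - X * (if j = σ i then 1 else 0)

/-- In the Leibniz expansion a nonzero term has τ i ∈ {i, σ i} for all i. The fixed points of τ are
closed under σ⁻¹, so transitivity leaves only τ = 1 and τ = σ. -/
theorem det_oneSubXPerm_of_transitive (σ : Equiv.Perm ι) (h : ∀ x y, σ.SameCycle x y)
    (hι : 2 ≤ Fintype.card ι) : (oneSubXPerm σ).det = 1 - X ^ Fintype.card ι := by
  have : Nontrivial ι := Fintype.one_lt_card_iff_nontrivial.mp hι
  have hfix : ∀ x, σ x ≠ x := by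
    intro x hx
    obtain ⟨y, hy⟩ := exists_ne x
    obtain ⟨k, hk⟩ := h x y
    exact hy (hk ▸ Function.IsFixedPt.perm_zpow (e := σ) hx k)
  have hcyc : σ.IsCycle := by
    obtain ⟨x, -⟩ := exists_pair_ne ι
    exact ⟨x, hfix x, fun y _ => h x y⟩
  have hsupp : σ.support = Finset.univ := by
    ext x; simp [hfix x]
  have hne : (1 : Equiv.Perm ι) ≠ σ := by
    rintro rfl
    exact hcyc.ne_one rfl
  rw [← Matrix.det_transpose, Matrix.det_apply']
  have hzero : ∀ τ ∈ (Finset.univ : Finset (Equiv.Perm ι)), τ ∉ ({1, σ} : Finset _) →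
      ((Equiv.Perm.sign τ : ℤ) : ℚ[X]) * ∏ i, (oneSubXPerm σ).transpose (τ i) i = 0 := by
    intro τ _ hτ
    simp only [Finset.mem_insert, Finset.mem_singleton, not_or] at hτ
    by_contra hprod
    have hcase : ∀ i, τ i = i ∨ τ i = σ i := by
      intro i
      by_contra hi
      push Not at hi
      refine hprod (mul_eq_zero_of_right _ (Finset.prod_eq_zero (Finset.mem_univ i) ?_))
      simp [oneSubXPerm, hi.1, hi.2]
    have hback : ∀ i, τ i = i → τ (σ.symm i) = σ.symm i := by
      intro i hi
      rcases hcase (σ.symm i) with h' | h'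
      · exact h'
      · rw [Equiv.apply_symm_apply] at h'
        have := τ.injective (h'.trans hi.symm)
        rw [this, hi]
    by_cases hex : ∃ i, τ i = i
    · obtain ⟨i, hi⟩ := hex
      apply hτ.1
      ext j
      obtain ⟨k, hk⟩ := (h j i).exists_pow_eq'
      have : ∀ (k : ℕ) (j : ι), τ ((σ ^ k) j) = (σ ^ k) j → τ j = j := by
        intro k
        induction k with
        | zero => intro j hj; simpa using hj
        | succ k ih =>
          intro j hj
          rw [pow_succ, Equiv.Perm.mul_apply] at hj
          have := hback _ (ih _ hj)
          simpa using this
      exact this k j (by rw [hk.2, hi])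
    · push Not at hex
      apply hτ.2
      ext j
      exact (hcase j).resolve_left (hex j)
  rw [← Finset.sum_subset (Finset.subset_univ {1, σ}) hzero, Finset.sum_pair hne]
  have e1 : ∏ i, (oneSubXPerm σ).transpose ((1 : Equiv.Perm ι) i) i = 1 := by
    refine Finset.prod_eq_one fun i _ => ?_
    simp [oneSubXPerm, (hfix i).symm]
  have e2 : ∏ i, (oneSubXPerm σ).transpose (σ i) i = (-X) ^ Fintype.card ι := by
    rw [← Finset.card_univ, ← Finset.prod_const]
    refine Finset.prod_congr rfl fun i _ => ?_
    simp [oneSubXPerm, hfix i]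
  rw [e1, e2, hcyc.sign, hsupp, Finset.card_univ, neg_pow (X : ℚ[X])]
  have : ((-1 : ℚ[X]) ^ Fintype.card ι) * (-1) ^ Fintype.card ι = 1 := by
    rw [← mul_pow]; simp
  simp only [Equiv.Perm.sign_one, Units.val_neg, Units.val_pow_eq_pow_val, Units.val_one]
  push_cast
  linear_combination (-(X : ℚ[X]) ^ Fintype.card ι) * this

/-- A principal block of `1 - X P` on a nonempty invariant set is singular at `X = 1`. -/
theorem X_sub_one_dvd_det_block (σ : Equiv.Perm ι) (p : ι → Prop) [DecidablePred p]
    (hp : ∀ i, p i → p (σ i)) (hne : ∃ i, p i) :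
    (X - 1 : ℚ[X]) ∣ ((oneSubXPerm σ).toSquareBlockProp p).det := by
  have : (X - 1 : ℚ[X]) = X - C 1 := by simp
  rw [this, dvd_iff_isRoot, IsRoot.def, ← coe_evalRingHom, RingHom.map_det,
    ← Matrix.exists_mulVec_eq_zero_iff]
  obtain ⟨i, hi⟩ := hne
  -- At X = 1 the rows of the block sum to zero, so the all-ones vector is in the kernel.
  refine ⟨fun _ => 1, fun h => one_ne_zero (congrFun h ⟨i, hi⟩), ?_⟩
  ext ⟨j, hj⟩
  have h1 : ∀ x : {i // p i}, (x : ι) = j ↔ x = ⟨j, hj⟩ := fun x => by rw [Subtype.ext_iff]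
  have h2 : ∀ x : {i // p i}, (x : ι) = σ j ↔ x = ⟨σ j, hp j hj⟩ :=
    fun x => by rw [Subtype.ext_iff]
  simp [Matrix.mulVec, dotProduct, oneSubXPerm, Matrix.toSquareBlockProp, apply_ite (eval (1 : ℚ)),
    h1, h2]

/-- A cycle and its complement are both invariant and nonempty; each block contributes one factor X
- 1. -/
theorem sq_dvd_det_oneSubXPerm (σ : Equiv.Perm ι) (h : ¬ ∀ x y, σ.SameCycle x y) :
    (X - 1 : ℚ[X]) ^ 2 ∣ (oneSubXPerm σ).det := by
  classical
  push Not at h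
  obtain ⟨x, y, hxy⟩ := h
  have hp : ∀ i, σ.SameCycle x i → σ.SameCycle x (σ i) := fun i hi => by
    simpa [Equiv.Perm.sameCycle_apply_right] using hi
  have hq : ∀ i, ¬ σ.SameCycle x i → ¬ σ.SameCycle x (σ i) := fun i hi => by
    simpa [Equiv.Perm.sameCycle_apply_right] using hi
  rw [Matrix.twoBlockTriangular_det (oneSubXPerm σ) (fun i => σ.SameCycle x i), pow_two]
  · exact mul_dvd_mul (X_sub_one_dvd_det_block σ _ hp ⟨x, Equiv.Perm.SameCycle.refl _ _⟩)
      (X_sub_one_dvd_det_block σ _ hq ⟨y, hxy⟩)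
  · intro i hi j hj
    have h1 : j ≠ i := by rintro rfl; exact hi hj
    have h2 : j ≠ σ i := by rintro rfl; exact hq i hi hj
    simp [oneSubXPerm, h1, h2]

theorem eval_derivative_det_oneSubXPerm (σ : Equiv.Perm ι) (hι : 2 ≤ Fintype.card ι)
    [Decidable (∀ x y, σ.SameCycle x y)] :
    (derivative (oneSubXPerm σ).det).eval 1 =
      if ∀ x y, σ.SameCycle x y then -(Fintype.card ι : ℚ) else 0 := by
  split_ifs with h
  · rw [det_oneSubXPerm_of_transitive σ h hι]
    simp [derivative_X_pow]
  · obtain ⟨q, hq⟩ := sq_dvd_det_oneSubXPerm σ h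
    rw [hq]
    simp [derivative_mul, derivative_pow]

end PermutationMatrix

/-! ### Counting full-cycle shift registers. -/

section ShiftRegister

/-- The binary words of length `d`. -/
abbrev Word (d : ℕ) : Type := Fin d → Fin 2

/-- One step of the nonsingular shift register with feedback function `f`. -/
def shiftStep {d : ℕ} (f : Word d → Fin 2) (x : Word (d + 1)) : Word (d + 1) :=
  Fin.snoc (α := fun _ => Fin 2) (Fin.tail x) (f (Fin.tail x) + x 0)

theorem shiftStep_injective {d : ℕ} (f : Word d → Fin 2) : Function.Injective (shiftStep f) := by
  intro x y h
  have h1 : Fin.tail x = Fin.tail y := by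
    have := congrArg (Fin.init (α := fun _ => Fin 2)) h
    simpa [shiftStep] using this
  have h2 : x 0 = y 0 := by
    have := congrFun h (Fin.last d)
    simpa [shiftStep, h1] using this
  rw [← Fin.cons_self_tail x, ← Fin.cons_self_tail y, h1, h2]

/-- The permutation of the words of length `d + 1` made by a nonsingular shift register. -/
noncomputable def shiftPerm {d : ℕ} (f : Word d → Fin 2) : Equiv.Perm (Word (d + 1)) :=
  Equiv.ofBijective (shiftStep f) (Finite.injective_iff_bijective.mp (shiftStep_injective f))

theorem shiftPerm_apply {d : ℕ} (f : Word d → Fin 2) (x : Word (d + 1)) :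
    shiftPerm f x = Fin.snoc (α := fun _ => Fin 2) (Fin.tail x) (f (Fin.tail x) + x 0) := rfl

theorem card_word (d : ℕ) : Fintype.card (Word d) = 2 ^ d := by simp

/-- `X` times the transition matrix of the random walk on the words of length `d + 1`. -/
noncomputable def walkMatrix (d : ℕ) : Matrix (Word (d + 1)) (Word (d + 1)) ℚ[X] :=
  Matrix.of fun x y => if Fin.init y = Fin.tail x then X * C (1 / 2) else 0

theorem init_tail_iff {n : ℕ} (v w : Word (n + 1)) (y : Word (n + 2)) :
    (Fin.init y = v ∧ Fin.tail y = w) ↔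
      (y = Fin.snoc (α := fun _ => Fin 2) v (w (Fin.last n)) ∧ Fin.init w = Fin.tail v) := by
  constructor
  · rintro ⟨rfl, rfl⟩
    refine ⟨?_, ?_⟩
    · conv_lhs => rw [← Fin.snoc_init_self y]
      rfl
    · rfl
  · rintro ⟨rfl, h⟩
    refine ⟨by simp, ?_⟩
    funext i
    refine Fin.lastCases ?_ (fun i => ?_) i
    · exact Fin.snoc_last (α := fun _ => Fin 2) (w (Fin.last n)) v
    · have := congrFun h i
      simp only [Fin.init, Fin.tail] at this ⊢
      rw [this, ← Fin.castSucc_succ, Fin.snoc_castSucc]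

/-- The matrix factors as MN through the words one letter shorter, and NM is the walk matrix on
those, since overlapping words v, w have a unique common extension. As det(1 - MN) = det(1 - NM),
induction descends to a 1 × 1 matrix. -/
theorem det_one_sub_walkMatrix (d : ℕ) : (1 - walkMatrix d).det = 1 - X := by
  have key : ∀ d, walkMatrix d =
      (Matrix.of fun (x : Word (d + 1)) (v : Word d) => if Fin.tail x = v then (1 : ℚ[X]) else 0) *
      (Matrix.of fun (v : Word d) (y : Word (d + 1)) =>
        if Fin.init y = v then (X * C (1 / 2) : ℚ[X]) else 0) := by
    intro d
    ext1 x y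
    simp [Matrix.mul_apply, walkMatrix, eq_comm (a := Fin.tail x)]
  induction d with
  | zero =>
    rw [key, Matrix.det_one_sub_mul_comm, Matrix.det_unique]
    simp only [Matrix.sub_apply, Matrix.one_apply_eq, Matrix.mul_apply, Matrix.of_apply]
    rw [Finset.sum_congr rfl fun y _ => by
      rw [if_pos (Subsingleton.elim _ _), if_pos (Subsingleton.elim _ _)]]
    simp only [mul_one, Finset.sum_const, Finset.card_univ, card_word]
    have : (2 : ℚ[X]) * C (1 / 2) = 1 := by
      rw [← map_ofNat C 2, ← C_mul]; norm_num
    simp only [zero_add, pow_one, nsmul_eq_mul, Nat.cast_ofNat]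
    linear_combination (-X : ℚ[X]) * this
  | succ n ih =>
    rw [key, Matrix.det_one_sub_mul_comm, ← ih]
    congr 2
    ext1 v w
    simp only [Matrix.mul_apply, Matrix.of_apply, walkMatrix, mul_ite, mul_one, mul_zero,
      ← ite_and]
    have : ∀ y : Word (n + 2), (Fin.tail y = w ∧ Fin.init y = v) ↔
        (y = Fin.snoc (α := fun _ => Fin 2) v (w (Fin.last n)) ∧ Fin.init w = Fin.tail v) :=
      fun y => and_comm.trans (init_tail_iff v w y)
    simp only [this, ite_and, Finset.sum_ite_eq', Finset.mem_univ, if_true]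

/-- A word of length `d + 1` is a letter followed by a word of length `d`. -/
noncomputable def consEquiv (d : ℕ) : Word d ⊕ Word d ≃ Word (d + 1) :=
  Equiv.ofBijective (Sum.elim (Fin.cons (α := fun _ => Fin 2) 0) (Fin.cons (α := fun _ => Fin 2) 1))
    (by
      constructor
      · rintro (v | v) (w | w) h
        · exact congrArg _ (Fin.cons_injective2 h).2
        · exact absurd (Fin.cons_injective2 h).1 (by decide)
        · exact absurd (Fin.cons_injective2 h).1 (by decide)
        · exact congrArg _ (Fin.cons_injective2 h).2
      · intro x
        have h : x 0 = 0 ∨ x 0 = 1 := by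
          generalize x 0 = a
          revert a; decide
        rcases h with h | h
        · exact ⟨Sum.inl (Fin.tail x), by simp [← h]⟩
        · exact ⟨Sum.inr (Fin.tail x), by simp [← h]⟩)

theorem consEquiv_inl (d : ℕ) (v : Word d) :
    consEquiv d (Sum.inl v) = Fin.cons (α := fun _ => Fin 2) 0 v := rfl

theorem consEquiv_inr (d : ℕ) (v : Word d) :
    consEquiv d (Sum.inr v) = Fin.cons (α := fun _ => Fin 2) 1 v := rfl

/-- The states 0v and 1v step to v followed by f v and by f v + 1, which is the pairing required by
`det_average_eq`; the averaged rows are those of the walk matrix. -/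
theorem sum_det_shiftPerm (d : ℕ) :
    ∑ f : Word d → Fin 2, (oneSubXPerm (shiftPerm f)).det = 2 ^ 2 ^ d * (1 - X) := by
  let O : Word d → Fin 2 → Word d ⊕ Word d → ℚ[X] := fun v b j =>
    X * if consEquiv d j = Fin.snoc (α := fun _ => Fin 2) v b then 1 else 0
  let E₀ : Word d → Word d ⊕ Word d → ℚ[X] := fun v j =>
    if consEquiv d j = Fin.cons (α := fun _ => Fin 2) 0 v then 1 else 0
  let E₁ : Word d → Word d ⊕ Word d → ℚ[X] := fun v j =>
    if consEquiv d j = Fin.cons (α := fun _ => Fin 2) 1 v then 1 else 0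
  have hc : (2 : ℚ[X]) * C (1 / 2) = 1 := by
    rw [← map_ofNat C 2, ← C_mul]; norm_num
  have h := det_average_eq E₀ E₁ O (C (1 / 2)) hc
  have h1 : ∀ f : Word d → Fin 2, (oneSubXPerm (shiftPerm f)).det = Matrix.det (Matrix.of
      (Sum.elim (fun v => E₀ v - O v (f v)) (fun v => E₁ v - O v (f v + 1)))) := by
    intro f
    rw [← Matrix.det_submatrix_equiv_self (consEquiv d)]
    congr 1
    ext1 i j
    rcases i with v | v
    · simp only [oneSubXPerm, Matrix.submatrix_apply, Matrix.of_apply, Sum.elim_inl, O, E₀,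
        shiftPerm_apply, consEquiv_inl, Fin.tail_cons, Fin.cons_zero, Pi.sub_apply, add_zero]
    · simp only [oneSubXPerm, Matrix.submatrix_apply, Matrix.of_apply, Sum.elim_inr, O, E₁,
        shiftPerm_apply, consEquiv_inr, Fin.tail_cons, Fin.cons_zero, Pi.sub_apply]
  have hO : ∀ v j, C (1 / 2) * (O v 0 j + O v 1 j) =
      if Fin.init (consEquiv d j) = v then X * C (1 / 2) else 0 := by
    intro v j
    simp only [O]
    generalize consEquiv d j = y
    have hy : y (Fin.last d) = 0 ∨ y (Fin.last d) = 1 := by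
      generalize y (Fin.last d) = a
      revert a; decide
    have h2 : ∀ b, y = Fin.snoc (α := fun _ => Fin 2) v b ↔
        Fin.init y = v ∧ y (Fin.last d) = b := by
      intro b
      constructor
      · rintro rfl; simp
      · rintro ⟨rfl, rfl⟩; simp
    simp only [h2]
    by_cases hv : Fin.init y = v
    · rcases hy with hy | hy
      · rw [if_pos ⟨hv, hy⟩, if_neg (by simp [hy]), if_pos hv]; ring
      · rw [if_neg (by simp [hy]), if_pos ⟨hv, hy⟩, if_pos hv]; ring
    · rw [if_neg (fun h => hv h.1), if_neg (fun h => hv h.1), if_neg hv]; ring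
  have h2 : (1 - walkMatrix d).det = Matrix.det (Matrix.of
      (Sum.elim (fun v => E₀ v - (C (1 / 2) : ℚ[X]) • (O v 0 + O v 1))
      (fun v => E₁ v - (C (1 / 2) : ℚ[X]) • (O v 0 + O v 1)))) := by
    rw [← Matrix.det_submatrix_equiv_self (consEquiv d)]
    congr 1
    ext1 i j
    rcases i with v | v
    · simp only [Matrix.submatrix_apply, Matrix.sub_apply, Matrix.of_apply, Sum.elim_inl,
        Pi.sub_apply, Pi.smul_apply, Pi.add_apply, smul_eq_mul, hO]
      rw [Matrix.one_apply, walkMatrix, Matrix.of_apply, consEquiv_inl, Fin.tail_cons,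
        ← consEquiv_inl]
      simp only [E₀, ← consEquiv_inl, (consEquiv d).injective.eq_iff, eq_comm (a := j)]
    · simp only [Matrix.submatrix_apply, Matrix.sub_apply, Matrix.of_apply, Sum.elim_inr,
        Pi.sub_apply, Pi.smul_apply, Pi.add_apply, smul_eq_mul, hO]
      rw [Matrix.one_apply, walkMatrix, Matrix.of_apply, consEquiv_inr, Fin.tail_cons,
        ← consEquiv_inr]
      simp only [E₁, ← consEquiv_inr, (consEquiv d).injective.eq_iff, eq_comm (a := j)]
  rw [← h2, det_one_sub_walkMatrix, card_word] at h
  rw [h, Finset.sum_congr rfl fun f _ => h1 f, ← mul_assoc, ← mul_pow, hc, one_pow, one_mul]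

/-- The number of binary nonsingular shift registers that run through all states in one cycle. -/
theorem card_transitive_shiftPerm (d : ℕ) :
    Nat.card {f : Word d → Fin 2 // ∀ x y, (shiftPerm f).SameCycle x y} * 2 ^ (d + 1) =
      2 ^ 2 ^ d := by
  classical
  have h := congrArg (fun p : ℚ[X] => (derivative p).eval 1) (sum_det_shiftPerm d)
  have hcard : 2 ≤ Fintype.card (Word (d + 1)) := by
    rw [card_word, pow_succ]
    have := Nat.one_le_two_pow (n := d)
    omega
  simp only [derivative_sum, eval_finsetSum, eval_derivative_det_oneSubXPerm _ hcard] at h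
  rw [← Finset.sum_filter, Finset.sum_const, ← Fintype.card_subtype, ← Nat.card_eq_fintype_card,
    card_word] at h
  have e : (2 : ℚ[X]) ^ 2 ^ d = C (2 ^ 2 ^ d) := by
    rw [C_pow, map_ofNat]
  rw [e, derivative_C_mul] at h
  simp only [nsmul_eq_mul, derivative_sub, derivative_one, derivative_X, zero_sub, mul_neg,
    mul_one, eval_neg, eval_C, neg_inj] at h
  exact_mod_cast h

end ShiftRegister

/-! ### De Bruijn sequences as outputs of shift registers. -/

section Sequences

/-- The factor of length `d + 1` of the sequence `s` that starts at position `k`. -/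
def window (d : ℕ) (s : ℕ → Fin 2) (k : ℕ) : Word (d + 1) := fun i => s (k + i)

/-- A de Bruijn word of order `d + 1` with a marked starting position, as a periodic sequence. -/
structure IsDeBruijnSeq (d : ℕ) (s : ℕ → Fin 2) : Prop where
  periodic : Function.Periodic s (2 ^ (d + 1))
  surjective : Function.Surjective (window d s)

variable {d : ℕ} {s : ℕ → Fin 2}

theorem window_periodic (hs : Function.Periodic s (2 ^ (d + 1))) :
    Function.Periodic (window d s) (2 ^ (d + 1)) := by
  intro k
  funext i
  simp only [window]
  rw [add_right_comm, hs]

/-- One period has as many positions as there are words, so meeting every word means meeting each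
exactly once. -/
theorem bijective_window_of_surjective (hs : Function.Periodic s (2 ^ (d + 1)))
    (h : Function.Surjective (window d s)) :
    Function.Bijective (fun k : Fin (2 ^ (d + 1)) => window d s k) := by
  rw [Fintype.bijective_iff_surjective_and_card]
  refine ⟨fun x => ?_, by simp⟩
  obtain ⟨k, rfl⟩ := h x
  exact ⟨⟨k % 2 ^ (d + 1), Nat.mod_lt _ (by positivity)⟩, (window_periodic hs).map_mod_nat k⟩

theorem IsDeBruijnSeq.modEq (hs : IsDeBruijnSeq d s) {j k : ℕ}
    (h : window d s j = window d s k) : j ≡ k [MOD 2 ^ (d + 1)] := by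
  have hp := window_periodic hs.periodic
  rw [← hp.map_mod_nat j, ← hp.map_mod_nat k] at h
  have := (bijective_window_of_surjective hs.periodic hs.surjective).injective
    (a₁ := ⟨j % 2 ^ (d + 1), Nat.mod_lt _ (by positivity)⟩)
    (a₂ := ⟨k % 2 ^ (d + 1), Nat.mod_lt _ (by positivity)⟩) h
  exact congrArg Fin.val this

theorem window_eq_of_modEq (hs : Function.Periodic s (2 ^ (d + 1))) {j k : ℕ}
    (h : j ≡ k [MOD 2 ^ (d + 1)]) : window d s j = window d s k := by
  have hp := window_periodic hs
  rw [← hp.map_mod_nat j, ← hp.map_mod_nat k, h]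

theorem tail_window (k : ℕ) : Fin.tail (window d s k) = Fin.init (window d s (k + 1)) := by
  funext i
  simp only [Fin.tail, Fin.init, window, Fin.val_succ, Fin.val_castSucc]
  congr 1
  ring

/-- The output of the shift register with feedback function `f` and initial state `x`. -/
noncomputable def registerOutput (f : Word d → Fin 2) (x : Word (d + 1)) (k : ℕ) : Fin 2 :=
  ((shiftPerm f) ^ k) x 0

theorem window_registerOutput (f : Word d → Fin 2) (x : Word (d + 1)) (k : ℕ) :
    window d (registerOutput f x) k = ((shiftPerm f) ^ k) x := by
  have h : ∀ (i : ℕ) (hi : i < d + 1) (k : ℕ),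
      registerOutput f x (k + i) = ((shiftPerm f) ^ k) x ⟨i, hi⟩ := by
    intro i
    induction i with
    | zero => intro hi k; rfl
    | succ i ih =>
      intro hi k
      have h1 := ih (by omega) (k + 1)
      rw [pow_succ', Equiv.Perm.mul_apply, shiftPerm_apply] at h1
      have h2 : (⟨i, by omega⟩ : Fin (d + 1)) = Fin.castSucc ⟨i, by omega⟩ := rfl
      rw [h2, Fin.snoc_castSucc] at h1
      rw [show k + (i + 1) = k + 1 + i by ring, h1]
      rfl
  funext i
  exact h i i.2 k

theorem isDeBruijnSeq_registerOutput (f : Word d → Fin 2)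
    (hf : ∀ x y, (shiftPerm f).SameCycle x y) (x : Word (d + 1)) :
    IsDeBruijnSeq d (registerOutput f x) := by
  refine ⟨fun k => ?_, fun y => ?_⟩
  · have hfix : ∀ x, shiftPerm f x ≠ x := by
      intro x hx
      obtain ⟨y, hy⟩ := exists_ne x
      obtain ⟨k, hk⟩ := hf x y
      exact hy (hk ▸ Function.IsFixedPt.perm_zpow (e := shiftPerm f) hx k)
    have hcyc : (shiftPerm f).IsCycle := ⟨x, hfix x, fun y _ => hf x y⟩
    have hsupp : (shiftPerm f).support = Finset.univ := by
      ext x; simp [hfix x]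
    have hord := hcyc.orderOf
    rw [hsupp, Finset.card_univ, card_word] at hord
    simp only [registerOutput]
    rw [pow_add, ← hord, pow_orderOf_eq_one, mul_one]
  · obtain ⟨k, -, hk⟩ := (hf x y).exists_pow_eq'
    exact ⟨k, by rw [window_registerOutput, hk]⟩

theorem IsDeBruijnSeq.exists_feedback (hs : IsDeBruijnSeq d s) :
    ∃ f : Word d → Fin 2, ∀ k, shiftPerm f (window d s k) = window d s (k + 1) := by
  -- Let f v be the letter after the occurrence of 0v. The letter after 1v must then be f v + 1:
  -- otherwise the next windows, hence the positions of 0v and 1v, would agree.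
  choose g hg using fun v : Word d => hs.surjective (Fin.cons (α := fun _ => Fin 2) 0 v)
  refine ⟨fun v => window d s (g v + 1) (Fin.last d), fun k => ?_⟩
  rw [shiftPerm_apply, ← Fin.snoc_init_self (window d s (k + 1)), ← tail_window]
  congr 1
  have hsplit : ∀ a : Fin 2, a = 0 ∨ a = 1 := by decide
  set v : Word d := Fin.tail (window d s k) with hv
  rcases hsplit (window d s k 0) with h0 | h0
  · have : window d s (g v) = window d s k := by
      rw [hg, ← Fin.cons_self_tail (window d s k), h0]
    rw [window_eq_of_modEq hs.periodic ((hs.modEq this).add_right 1), h0, add_zero]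
  · have hne : window d s (g v + 1) (Fin.last d) ≠ window d s (k + 1) (Fin.last d) := by
      intro h
      have h1 : window d s (g v + 1) = window d s (k + 1) := by
        rw [← Fin.snoc_init_self (window d s (g v + 1)), ← Fin.snoc_init_self (window d s (k + 1)),
          h, ← tail_window, ← tail_window, hg, Fin.tail_cons]
      have h2 := window_eq_of_modEq hs.periodic ((hs.modEq h1).add_right_cancel' 1)
      have h3 := congrFun h2 0
      rw [hg, h0, Fin.cons_zero] at h3
      exact absurd h3 (by decide)
    rw [h0]
    revert hne
    generalize window d s (g v + 1) (Fin.last d) = a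
    generalize window d s (k + 1) (Fin.last d) = b
    revert a b
    decide

theorem card_isDeBruijnSeq (d : ℕ) : Nat.card {s // IsDeBruijnSeq d s} = 2 ^ 2 ^ d := by
  -- The factor 2^(d+1) is read as the number of initial states.
  rw [← card_transitive_shiftPerm d, ← card_word (d + 1), ← Nat.card_eq_fintype_card,
    ← Nat.card_prod]
  refine (Nat.card_eq_of_bijective (fun p : {f : Word d → Fin 2 //
    ∀ x y, (shiftPerm f).SameCycle x y} × Word (d + 1) =>
    (⟨registerOutput p.1.1 p.2, isDeBruijnSeq_registerOutput _ p.1.2 _⟩ :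
      {s // IsDeBruijnSeq d s})) ⟨?_, ?_⟩).symm
  · rintro ⟨⟨f, hf⟩, x⟩ ⟨⟨f', hf'⟩, x'⟩ h
    have h : registerOutput f x = registerOutput f' x' := congrArg Subtype.val h
    have hw : ∀ k, ((shiftPerm f) ^ k) x = ((shiftPerm f') ^ k) x' := fun k => by
      rw [← window_registerOutput, ← window_registerOutput, h]
    obtain rfl : x = x' := by simpa using hw 0
    have hff : f = f' := by
      funext v
      -- The orbit reaches 0v, and the last letter of the next state is f v; so the output
      -- determines f.
      obtain ⟨k, -, hk⟩ := (hf x (Fin.cons (α := fun _ => Fin 2) 0 v)).exists_pow_eq'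
      have h1 := hw (k + 1)
      rw [pow_succ', pow_succ', Equiv.Perm.mul_apply, Equiv.Perm.mul_apply, ← hw k, hk] at h1
      simpa [shiftPerm_apply] using congrFun h1 (Fin.last d)
    subst hff
    rfl
  · rintro ⟨s, hs⟩
    obtain ⟨f, hf⟩ := hs.exists_feedback
    have hpow : ∀ k, ((shiftPerm f) ^ k) (window d s 0) = window d s k := by
      intro k
      induction k with
      | zero => rfl
      | succ k ih => rw [pow_succ', Equiv.Perm.mul_apply, ih, hf]
    have hsame : ∀ x, (shiftPerm f).SameCycle (window d s 0) x := by
      intro x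
      obtain ⟨k, rfl⟩ := hs.surjective x
      exact ⟨k, by rw [zpow_natCast, hpow]⟩
    refine ⟨⟨⟨f, fun x y => (hsame x).symm.trans (hsame y)⟩, window d s 0⟩, Subtype.ext ?_⟩
    funext k
    simp [registerOutput, hpow, window]

end Sequences

/-! ### From marked words to necklaces. -/

section Lists

/-- `Nat.card` of an infinite type is 0, so n ≠ 0 is what makes the fibres finite. -/
theorem card_eq_card_mul_of_card_fiber {A B : Type*} (g : A → B) (n : ℕ) (hn : n ≠ 0)
    (h : ∀ b, Nat.card {a // g a = b} = n) : Nat.card A = Nat.card B * n := by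
  have e : ∀ b, {a // g a = b} ≃ Fin n := fun b =>
    have : Finite {a // g a = b} := Nat.finite_of_card_ne_zero (by rw [h]; exact hn)
    Finite.equivFinOfCardEq (h b)
  rw [← Nat.card_congr (Equiv.sigmaFiberEquiv g), Nat.card_congr (Equiv.sigmaCongrRight e),
    Nat.card_congr (Equiv.sigmaEquivProd _ _), Nat.card_prod, Nat.card_fin]

theorem cyclicPermutations_eq_map_range {α : Type*} {l : List α} (h : l ≠ []) :
    l.cyclicPermutations = (List.range l.length).map l.rotate := by
  apply List.ext_getElem
  · rw [List.length_cyclicPermutations_of_ne_nil _ h]; simp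
  · intro i h1 h2
    rw [List.getElem_cyclicPermutations]; simp

/-- If all rotations of the lists that represent the necklaces in `T` are distinct, then every
necklace in `T` is represented by `n` lists. -/
theorem card_lists_of_necklaces {α : Type*} (T : Set (Cycle α)) (n : ℕ) (hn : n ≠ 0)
    (hlen : ∀ c ∈ T, c.length = n)
    (hT : ∀ l : List α, (l : Cycle α) ∈ T → Set.InjOn l.rotate (Set.Iio n)) :
    Nat.card {l : List α // (l : Cycle α) ∈ T} = Nat.card T * n := by
  classical
  refine card_eq_card_mul_of_card_fiber
    (fun l : {l : List α // (l : Cycle α) ∈ T} => (⟨(l.1 : Cycle α), l.2⟩ : T)) n hn ?_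
  rintro ⟨c, hc⟩
  induction c using Quotient.inductionOn' with | h l =>
  change (l : Cycle α) ∈ T at hc
  have hl : l.length = n := hlen _ hc
  have hne : l ≠ [] := by
    rintro rfl
    exact hn hl.symm
  have hnd : l.cyclicPermutations.Nodup := by
    rw [cyclicPermutations_eq_map_range hne]
    refine List.Nodup.map_on (fun i hi j hj hij => ?_) List.nodup_range
    exact hT l hc (by simpa [hl] using hi) (by simpa [hl] using hj) hij
  have e : {a : {l : List α // (l : Cycle α) ∈ T} // (⟨(a.1 : Cycle α), a.2⟩ : T) = ⟨l, hc⟩} ≃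
      {a // a ∈ l.cyclicPermutations.toFinset} :=
    { toFun := fun a => ⟨a.1.1, by
        rw [List.mem_toFinset, List.mem_cyclicPermutations_iff]
        exact Cycle.coe_eq_coe.mp (congrArg Subtype.val a.2)⟩
      invFun := fun a =>
        have ha : (a.1 : Cycle α) = l := by
          rw [Cycle.coe_eq_coe, ← List.mem_cyclicPermutations_iff, ← List.mem_toFinset]
          exact a.2
        ⟨⟨a.1, ha ▸ hc⟩, Subtype.ext ha⟩
      left_inv := fun a => rfl
      right_inv := fun a => rfl }
  refine (Nat.card_congr e).trans ?_
  rw [Nat.card_eq_fintype_card, Fintype.card_coe, List.toFinset_card_of_nodup hnd,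
    List.length_cyclicPermutations_of_ne_nil _ hne, hl]

end Lists

/-! ### Counting de Bruijn words. -/

section DeBruijn

/-- The periodic sequence whose period is the list `l`. -/
def periodicSeq (l : List (Fin 2)) (k : ℕ) : Fin 2 := l.getD (k % l.length) 0

theorem periodic_periodicSeq (l : List (Fin 2)) : Function.Periodic (periodicSeq l) l.length :=
  fun k => by simp [periodicSeq]

theorem prefix_rotate_iff {d : ℕ} {l : List (Fin 2)} (hl : d + 1 ≤ l.length) (x : Word (d + 1))
    (k : ℕ) : List.ofFn x <+: l.rotate k ↔ window d (periodicSeq l) k = x := by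
  rw [List.prefix_iff_eq_take, List.length_ofFn]
  have key : (l.rotate k).take (d + 1) = List.ofFn (window d (periodicSeq l) k) := by
    apply List.ext_getElem
    · simp [hl]
    · intro i h1 h2
      have : (i + k) % l.length < l.length := Nat.mod_lt _ (by omega)
      rw [List.getElem_take, List.getElem_rotate, List.getElem_ofFn]
      simp [window, periodicSeq, add_comm k i, this]
  rw [key, List.ofFn_inj, eq_comm]

theorem occurrences_coe {d : ℕ} {l : List (Fin 2)} (hl : l.length = 2 ^ (d + 1))
    (x : Word (d + 1)) : occurrences (l : Cycle (Fin 2)) (List.ofFn x) =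
      ((Finset.range (2 ^ (d + 1))).filter fun k => window d (periodicSeq l) k = x).card := by
  have hne : l ≠ [] := by
    rintro rfl
    exact absurd hl.symm (by simp)
  have hd : d + 1 ≤ l.length := hl ▸ Nat.lt_two_pow_self.le
  rw [occurrences, Cycle.lists_coe, Multiset.coe_countP, cyclicPermutations_eq_map_range hne,
    List.countP_map, hl, ← List.toFinset_range, List.nodup_range.card_eq_countP]
  refine List.countP_congr fun k _ => ?_
  simp only [Function.comp_apply, decide_eq_true_eq, prefix_rotate_iff hd]

theorem mem_binaryDeBruijnWords_iff (d : ℕ) (l : List (Fin 2)) :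
    (l : Cycle (Fin 2)) ∈ binaryDeBruijnWords (d + 1) ↔
      l.length = 2 ^ (d + 1) ∧ IsDeBruijnSeq d (periodicSeq l) := by
  constructor
  · rintro ⟨hl, hocc⟩
    change l.length = 2 ^ (d + 1) at hl
    refine ⟨hl, hl ▸ periodic_periodicSeq l, fun x => ?_⟩
    have h := hocc (List.ofFn x) List.length_ofFn
    rw [occurrences_coe hl] at h
    obtain ⟨k, hk⟩ := Finset.card_pos.mp (h ▸ Nat.one_pos)
    exact ⟨k, (Finset.mem_filter.mp hk).2⟩
  · rintro ⟨hl, hs⟩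
    refine ⟨hl, fun u hu => ?_⟩
    obtain ⟨x, rfl⟩ : ∃ x : Word (d + 1), u = List.ofFn x := by
      rw [← hu]
      exact ⟨u.get, (List.ofFn_get u).symm⟩
    rw [occurrences_coe hl, Finset.card_eq_one]
    obtain ⟨k, hk⟩ := (bijective_window_of_surjective hs.periodic hs.surjective).surjective x
    refine ⟨k, Finset.ext fun j => ?_⟩
    simp only [Finset.mem_filter, Finset.mem_range, Finset.mem_singleton]
    constructor
    · rintro ⟨hj, hj'⟩
      exact (hs.modEq (hj'.trans hk.symm)).eq_of_lt_of_lt hj k.2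
    · rintro rfl
      exact ⟨k.2, hk⟩

theorem card_deBruijn_lists (d : ℕ) :
    Nat.card {l : List (Fin 2) // (l : Cycle (Fin 2)) ∈ binaryDeBruijnWords (d + 1)} =
      2 ^ 2 ^ d := by
  rw [← card_isDeBruijnSeq d]
  have hM : 0 < 2 ^ (d + 1) := by positivity
  refine Nat.card_eq_of_bijective (fun l => (⟨periodicSeq l.1,
    ((mem_binaryDeBruijnWords_iff d l.1).mp l.2).2⟩ : {s // IsDeBruijnSeq d s})) ⟨?_, ?_⟩
  · rintro ⟨l, hl⟩ ⟨l', hl'⟩ h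
    have h : periodicSeq l = periodicSeq l' := congrArg Subtype.val h
    have h1 := ((mem_binaryDeBruijnWords_iff d l).mp hl).1
    have h2 := ((mem_binaryDeBruijnWords_iff d l').mp hl').1
    refine Subtype.ext (List.ext_getElem (h1.trans h2.symm) fun i hi hi' => ?_)
    have := congrFun h i
    simpa [periodicSeq, Nat.mod_eq_of_lt hi, Nat.mod_eq_of_lt hi', hi, hi'] using this
  · rintro ⟨s, hs⟩
    have h : periodicSeq (List.ofFn fun i : Fin (2 ^ (d + 1)) => s i) = s := by
      funext k
      have := Nat.mod_lt k hM
      simp [periodicSeq, List.getD_eq_getElem?_getD, this,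
        hs.periodic.map_mod_nat k]
    refine ⟨⟨List.ofFn fun i : Fin (2 ^ (d + 1)) => s i,
      (mem_binaryDeBruijnWords_iff d _).mpr ⟨List.length_ofFn, by rwa [h]⟩⟩, Subtype.ext h⟩

/-- The number of binary de Bruijn words of order `d + 1`. -/
theorem card_binaryDeBruijnWords (d : ℕ) :
    Nat.card (binaryDeBruijnWords (d + 1)) * 2 ^ (d + 1) = 2 ^ 2 ^ d := by
  rw [← card_deBruijn_lists d]
  refine (card_lists_of_necklaces _ _ (by positivity) (fun c hc => hc.length_eq) ?_).symm
  intro l hl i hi j hj hij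
  obtain ⟨h1, hs⟩ := (mem_binaryDeBruijnWords_iff d l).mp hl
  have hd : d + 1 ≤ l.length := h1 ▸ Nat.lt_two_pow_self.le
  refine (hs.modEq ?_).eq_of_lt_of_lt hi hj
  rw [← prefix_rotate_iff hd, hij, prefix_rotate_iff hd]

end DeBruijn

/-! ### Counting odd necklaces. -/

section OddNecklaces

theorem mem_oddBinaryNecklaces_iff (n : ℕ) (l : List (Fin 2)) :
    (l : Cycle (Fin 2)) ∈ oddBinaryNecklaces n ↔ l.length = n ∧ Odd (l.count 1) := by
  rw [oddBinaryNecklaces, Set.mem_ofPred_eq, Cycle.length_coe, Cycle.coe_toMultiset,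
    Multiset.coe_count]

/-- The first letter is a parity bit determined by the remaining n letters. -/
theorem card_odd_lists (n : ℕ) :
    Nat.card {l : List (Fin 2) // (l : Cycle (Fin 2)) ∈ oddBinaryNecklaces (n + 1)} = 2 ^ n := by
  have hv : Nat.card {l : List (Fin 2) // l.length = n} = 2 ^ n := by
    have := card_vector (α := Fin 2) n
    rw [Fintype.card_fin, ← Nat.card_eq_fintype_card] at this
    exact this
  rw [← hv]
  have hsplit : ∀ a : Fin 2, a = 0 ∨ a = 1 := by decide
  refine (Nat.card_eq_of_bijective (fun l : {l : List (Fin 2) // l.length = n} =>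
    (⟨(if Odd (l.1.count 1) then 0 else 1) :: l.1, by
      rw [mem_oddBinaryNecklaces_iff, List.length_cons, l.2]
      refine ⟨rfl, ?_⟩
      split_ifs with h
      · simpa using h
      · simpa [Nat.odd_add_one] using h⟩ :
      {l : List (Fin 2) // (l : Cycle (Fin 2)) ∈ oddBinaryNecklaces (n + 1)})) ⟨?_, ?_⟩).symm
  · rintro ⟨l, hl⟩ ⟨l', hl'⟩ h
    exact Subtype.ext (List.cons.inj (congrArg Subtype.val h)).2
  · rintro ⟨l, hl⟩
    rw [mem_oddBinaryNecklaces_iff] at hl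
    rcases l with _ | ⟨a, l⟩
    · simp at hl
    · refine ⟨⟨l, by simpa using hl.1⟩, Subtype.ext ?_⟩
      change _ :: l = a :: l
      congr 1
      have h2 := hl.2
      rcases hsplit a with rfl | rfl
      · rw [if_pos (by simpa using h2)]
      · rw [if_neg (by simpa [Nat.odd_add_one] using h2)]

theorem iterate_rotate_one {α : Type*} (l : List α) (k : ℕ) :
    (fun l : List α => l.rotate 1)^[k] l = l.rotate k := by
  induction k with
  | zero => simp
  | succ k ih => rw [Function.iterate_succ_apply', ih, List.rotate_rotate]

/-- A binary word of length `2 ^ d` with an odd number of letters `1` is fixed by no nontrivial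
rotation. -/
theorem rotate_ne_self_of_odd {d : ℕ} {l : List (Fin 2)} (hl : l.length = 2 ^ d)
    (hodd : Odd (l.count 1)) {k : ℕ} (hk : 0 < k) (hk' : k < 2 ^ d) : l.rotate k ≠ l := by
  intro h
  have h1 : Function.IsPeriodicPt (fun l : List (Fin 2) => l.rotate 1) k l := by
    rw [Function.IsPeriodicPt, Function.IsFixedPt, iterate_rotate_one, h]
  have h2 : Function.IsPeriodicPt (fun l : List (Fin 2) => l.rotate 1) (2 ^ d) l := by
    rw [Function.IsPeriodicPt, Function.IsFixedPt, iterate_rotate_one, ← hl, List.rotate_length]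
  -- The least period is a power of 2 below 2^d, so it divides half the length; the two halves then
  -- agree and the weight is even.
  obtain ⟨e, he, hm⟩ := (Nat.dvd_prime_pow Nat.prime_two).mp h2.minimalPeriod_dvd
  have hle := hm ▸ Nat.le_of_dvd hk h1.minimalPeriod_dvd
  have hed : e < d := (Nat.pow_lt_pow_iff_right one_lt_two).mp (hle.trans_lt hk')
  obtain ⟨c, rfl⟩ : ∃ c, d = c + 1 := ⟨d - 1, by omega⟩
  have h3 : l.rotate (2 ^ c) = l := by
    rw [← iterate_rotate_one]
    refine (Function.isPeriodicPt_minimalPeriod _ l).trans_dvd ?_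
    rw [hm]
    exact pow_dvd_pow 2 (by omega)
  have hlen : 2 ^ c ≤ l.length := by rw [hl, pow_succ]; omega
  rw [List.rotate_eq_drop_append_take hlen] at h3
  have h4 := h3.trans (List.take_append_drop (2 ^ c) l).symm
  have h5 := (List.append_inj h4 (by simp [hl, pow_succ]; omega)).1
  rw [← List.take_append_drop (2 ^ c) l, List.count_append, h5] at hodd
  exact (Nat.not_odd_iff_even.mpr (Even.add_self _)) hodd

/-- The number of binary necklaces of length `2 ^ d` with an odd number of letters `1`. -/
theorem card_oddBinaryNecklaces (d : ℕ) :
    Nat.card (oddBinaryNecklaces (2 ^ d)) * 2 ^ d = 2 ^ (2 ^ d - 1) := by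
  have h1 : 2 ^ d = 2 ^ d - 1 + 1 := (Nat.sub_add_cancel Nat.one_le_two_pow).symm
  rw [← card_odd_lists (2 ^ d - 1), ← h1]
  refine (card_lists_of_necklaces _ _ (by positivity) (fun c hc => hc.1) ?_).symm
  intro l hl
  obtain ⟨hlen, hodd⟩ := (mem_oddBinaryNecklaces_iff _ l).mp hl
  have key : ∀ i j, i < j → j < 2 ^ d → l.rotate i ≠ l.rotate j := by
    intro i j hij hj h
    refine rotate_ne_self_of_odd hlen hodd (k := j - i) (by omega) (by omega) ?_
    apply List.rotate_injective i
    change (l.rotate (j - i)).rotate i = l.rotate i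
    rw [List.rotate_rotate, Nat.sub_add_cancel hij.le, h]
  intro i hi j hj hij
  rcases lt_trichotomy i j with h | h | h
  · exact absurd hij (key i j h hj)
  · exact h
  · exact absurd hij.symm (key j i h hi)

end OddNecklaces

/-! ### Counting normal bases. -/

section NormalBases

/-- The Frobenius map, as a linear map over the prime field. -/
noncomputable def frobeniusEnd (n : ℕ) : Module.End (ZMod 2) (GaloisField 2 n) :=
  (FiniteField.frobeniusAlgHom (ZMod 2) (GaloisField 2 n)).toLinearMap

theorem frobeniusEnd_pow_apply {n : ℕ} (i : ℕ) (x : GaloisField 2 n) :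
    (frobeniusEnd n ^ i) x = x ^ 2 ^ i := by
  induction i with
  | zero => simp
  | succ i ih =>
    rw [pow_succ', Module.End.mul_apply, ih, frobeniusEnd, AlgHom.toLinearMap_apply,
      FiniteField.coe_frobeniusAlgHom]
    simp only [ZMod.card]
    rw [← pow_mul, pow_succ]

theorem natCard_galoisField {n : ℕ} (hn : n ≠ 0) : Nat.card (GaloisField 2 n) = 2 ^ n :=
  GaloisField.card 2 n hn

theorem pow_two_pow_self {n : ℕ} (hn : n ≠ 0) (x : GaloisField 2 n) : x ^ 2 ^ n = x := by
  have := Fintype.ofFinite (GaloisField 2 n)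
  rw [← natCard_galoisField hn, Nat.card_eq_fintype_card, FiniteField.pow_card]

theorem pow_two_pow_mod {n : ℕ} (hn : n ≠ 0) (x : GaloisField 2 n) (i : ℕ) :
    x ^ 2 ^ (i % n) = x ^ 2 ^ i := by
  have h : Function.Periodic (fun i => x ^ 2 ^ i) n := fun i => by
    change x ^ 2 ^ (i + n) = x ^ 2 ^ i
    rw [pow_add, pow_mul, pow_two_pow_self hn]
  exact h.map_mod_nat i

/-- An element whose conjugates are linearly independent over the prime field. -/
def IsNormalElement {n : ℕ} (γ : GaloisField 2 n) : Prop :=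
  LinearIndependent (ZMod 2) (fun i : Fin n => γ ^ 2 ^ (i : ℕ))

/-- The set of conjugates of `γ`. -/
def conjugates {n : ℕ} (γ : GaloisField 2 n) : Set (GaloisField 2 n) :=
  Set.range (fun i : Fin n => γ ^ 2 ^ (i : ℕ))

theorem mem_normalBases_iff {n : ℕ} (hn : n ≠ 0) (S : Set (GaloisField 2 n)) :
    S ∈ normalBases 2 n ↔ ∃ γ, IsNormalElement γ ∧ conjugates γ = S := by
  constructor
  · rintro ⟨γ, b, hb, rfl⟩
    have : ⇑b = fun i : Fin n => γ ^ 2 ^ (i : ℕ) := funext hb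
    exact ⟨γ, by rw [IsNormalElement, ← this]; exact b.linearIndependent,
      by rw [conjugates, ← this]⟩
  · rintro ⟨γ, hγ, rfl⟩
    have : NeZero n := ⟨hn⟩
    let b := basisOfLinearIndependentOfCardEqFinrank hγ (by simp [GaloisField.finrank 2 hn])
    have hb : ⇑b = fun i : Fin n => γ ^ 2 ^ (i : ℕ) :=
      coe_basisOfLinearIndependentOfCardEqFinrank _ _
    exact ⟨γ, b, fun i => congrFun hb i, by rw [hb, conjugates]⟩

theorem conjugates_pow {n : ℕ} (hn : n ≠ 0) (γ : GaloisField 2 n) (j : Fin n) :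
    (IsNormalElement γ → IsNormalElement (γ ^ 2 ^ (j : ℕ))) ∧
      conjugates (γ ^ 2 ^ (j : ℕ)) = conjugates γ := by
  have : NeZero n := ⟨hn⟩
  have h : (fun i : Fin n => (γ ^ 2 ^ (j : ℕ)) ^ 2 ^ (i : ℕ)) =
      (fun i : Fin n => γ ^ 2 ^ (i : ℕ)) ∘ Equiv.addLeft j := by
    funext i
    rw [Function.comp_apply, Equiv.coe_addLeft, Fin.val_add, pow_two_pow_mod hn, ← pow_mul,
      ← pow_add]
  constructor
  · intro hγ
    rw [IsNormalElement, h]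
    exact hγ.comp _ (Equiv.injective _)
  · rw [conjugates, h, Set.range_comp, Equiv.range_eq_univ, Set.image_univ, conjugates]

/-- The generators of a normal basis are precisely its n distinct elements, as conjugating γ only
rotates the basis. -/
theorem card_normalElements {n : ℕ} (hn : n ≠ 0) :
    Nat.card {γ : GaloisField 2 n // IsNormalElement γ} = Nat.card (normalBases 2 n) * n := by
  refine card_eq_card_mul_of_card_fiber (fun γ : {γ : GaloisField 2 n // IsNormalElement γ} =>
    (⟨conjugates γ.1, (mem_normalBases_iff hn _).mpr ⟨γ.1, γ.2, rfl⟩⟩ : normalBases 2 n)) n hn ?_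
  rintro ⟨S, hS⟩
  obtain ⟨γ, hγ, rfl⟩ := (mem_normalBases_iff hn S).mp hS
  refine (Nat.card_eq_of_bijective (fun i : Fin n => (⟨⟨γ ^ 2 ^ (i : ℕ),
    (conjugates_pow hn γ i).1 hγ⟩, Subtype.ext (conjugates_pow hn γ i).2⟩ :
    {a : {γ : GaloisField 2 n // IsNormalElement γ} //
      (⟨conjugates a.1, (mem_normalBases_iff hn _).mpr ⟨a.1, a.2, rfl⟩⟩ : normalBases 2 n) =
        ⟨conjugates γ, hS⟩})) ⟨?_, ?_⟩).symm.trans (Nat.card_fin n)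
  · intro i j h
    exact hγ.injective (congrArg (fun a => a.1.1) h)
  · rintro ⟨⟨a, ha⟩, h⟩
    have h' : conjugates a = conjugates γ := congrArg Subtype.val h
    have hmem : a ∈ conjugates γ := by
      rw [← h']
      exact ⟨⟨0, Nat.pos_of_ne_zero hn⟩, by simp⟩
    obtain ⟨i, hi⟩ := hmem
    exact ⟨i, Subtype.ext (Subtype.ext hi)⟩

theorem X_sub_one_pow_two_pow_sub_one (d : ℕ) :
    (X - 1 : (ZMod 2)[X]) ^ (2 ^ d - 1) = ∑ i ∈ Finset.range (2 ^ d), X ^ i := by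
  have h0 : (X - 1 : (ZMod 2)[X]) ≠ 0 := by
    simpa using X_sub_C_ne_zero (1 : ZMod 2)
  apply mul_right_cancel₀ h0
  rw [geom_sum_mul, ← pow_succ, Nat.sub_add_cancel Nat.one_le_two_pow, sub_pow_char_pow, one_pow]

/-- As (φ - 1)^n = 0, a nonzero polynomial of degree below n that kills γ can be multiplied up to (φ
- 1)^(n-1), which sends γ to its trace. Conversely, zero trace is itself a linear relation among the
conjugates. -/
theorem isNormalElement_iff {d n : ℕ} (hn : n = 2 ^ d) (γ : GaloisField 2 n) :
    IsNormalElement γ ↔ Algebra.trace (ZMod 2) (GaloisField 2 n) γ ≠ 0 := by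
  have hn0 : n ≠ 0 := by rw [hn]; positivity
  have hn1 : 1 ≤ n := Nat.pos_of_ne_zero hn0
  set φ := frobeniusEnd n
  have htr : algebraMap (ZMod 2) (GaloisField 2 n) (Algebra.trace (ZMod 2) (GaloisField 2 n) γ) =
      ∑ i ∈ Finset.range n, γ ^ 2 ^ i := by
    rw [FiniteField.algebraMap_trace_eq_sum_pow, GaloisField.finrank 2 hn0]
    simp
  have htr0 : Algebra.trace (ZMod 2) (GaloisField 2 n) γ = 0 ↔
      ∑ i ∈ Finset.range n, γ ^ 2 ^ i = 0 := by
    rw [← htr, map_eq_zero (algebraMap (ZMod 2) (GaloisField 2 n))]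
  rw [Ne, htr0]
  constructor
  · intro h h0
    have h1 := Fintype.linearIndependent_iff.mp h (fun _ => 1)
      (by simpa [Finset.sum_range] using h0) ⟨0, hn1⟩
    exact one_ne_zero h1
  · intro h
    have hpow : aeval φ ((X - 1 : (ZMod 2)[X]) ^ n) = 0 := by
      have h1 : (X - 1 : (ZMod 2)[X]) ^ n = X ^ n - 1 := by rw [hn, sub_pow_char_pow, one_pow]
      rw [h1, map_sub, map_pow, aeval_X, map_one]
      ext x
      simp [φ, frobeniusEnd_pow_apply, pow_two_pow_self hn0]
    have hpow' : aeval φ ((X - 1 : (ZMod 2)[X]) ^ (n - 1)) γ = ∑ i ∈ Finset.range n, γ ^ 2 ^ i := by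
      have h1 : (X - 1 : (ZMod 2)[X]) ^ (n - 1) = ∑ i ∈ Finset.range n, X ^ i := by
        rw [hn, X_sub_one_pow_two_pow_sub_one]
      rw [h1, map_sum, LinearMap.sum_apply]
      simp [φ, frobeniusEnd_pow_apply]
    rw [IsNormalElement, Fintype.linearIndependent_iff]
    intro a ha
    by_contra hne
    push Not at hne
    obtain ⟨i₀, hi₀⟩ := hne
    let p : (ZMod 2)[X] := ∑ i : Fin n, C (a i) * X ^ (i : ℕ)
    have hp0 : p ≠ 0 := by
      intro hp
      have := congrArg (fun q => coeff q i₀) hp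
      simp [p, coeff_C_mul, coeff_X_pow, Fin.val_inj] at this
      exact hi₀ this
    have hpdeg : p.natDegree < n := by
      refine (natDegree_lt_iff_degree_lt hp0).mpr ?_
      exact degree_sum_fin_lt a
    have hpγ : aeval φ p γ = 0 := by
      rw [← ha]
      simp [p, φ, frobeniusEnd_pow_apply, Module.algebraMap_end_apply]
    obtain ⟨q, hq, hq1⟩ := exists_eq_pow_rootMultiplicity_mul_and_not_dvd p hp0 1
    set k := rootMultiplicity 1 p
    have hk : k ≤ n - 1 := by
      have := (rootMultiplicity_le_iff hp0 1 (n - 1)).mpr ?_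
      · exact this
      · intro hdvd
        have := natDegree_le_of_dvd hdvd hp0
        rw [natDegree_pow, natDegree_X_sub_C] at this
        omega
    rw [C_1] at hq hq1
    obtain ⟨r, hr⟩ := X_sub_C_dvd_sub_C_eval (a := (1 : ZMod 2)) (p := q)
    rw [C_1] at hr
    have hq1' : q.eval 1 ≠ 0 := by
      intro h1
      rw [h1, C_0, sub_zero] at hr
      exact hq1 ⟨r, hr⟩
    -- Modulo (X - 1)^n only the value of the cofactor q at 1 matters, and it is nonzero.
    have hmain : (X - 1 : (ZMod 2)[X]) ^ (n - 1 - k) * p =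
        C (q.eval 1) * (X - 1) ^ (n - 1) + r * (X - 1) ^ n := by
      have e1 : (X - 1 : (ZMod 2)[X]) ^ (n - 1) = (X - 1) ^ (n - 1 - k) * (X - 1) ^ k := by
        rw [← pow_add, Nat.sub_add_cancel hk]
      have e2 : (X - 1 : (ZMod 2)[X]) ^ n = (X - 1) ^ (n - 1) * (X - 1) := by
        rw [← pow_succ, Nat.sub_add_cancel hn1]
      have e3 : q = C (q.eval 1) + (X - 1) * r := by rw [← hr]; ring
      calc _ = (X - 1 : (ZMod 2)[X]) ^ (n - 1 - k) * ((X - 1) ^ k * q) := by rw [← hq]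
        _ = (X - 1) ^ (n - 1) * q := by rw [e1]; ring
        _ = (X - 1) ^ (n - 1) * (C (q.eval 1) + (X - 1) * r) := by rw [← e3]
        _ = _ := by rw [e2]; ring
    have h2 := congrArg (fun P => aeval φ P γ) hmain
    simp only [map_mul, map_add, hpow, mul_zero, add_zero, Module.End.mul_apply, hpγ, map_zero,
      hpow', aeval_C, Module.algebraMap_end_apply] at h2
    exact (smul_ne_zero hq1' h) h2.symm

theorem card_ne_zero_mul_two {G : Type*} [AddCommGroup G] [Finite G] (f : G →+ ZMod 2)
    (hf : Function.Surjective f) : Nat.card {x // f x ≠ 0} * 2 = Nat.card G := by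
  classical
  obtain ⟨x₀, hx₀⟩ := hf 1
  have h01 : ∀ a : ZMod 2, a + 1 ≠ 0 ↔ ¬ a ≠ 0 := by decide
  -- Translation by an element of value 1 exchanges the two fibres.
  have e : {x // f x ≠ 0} ≃ {x // ¬ f x ≠ 0} :=
    ((Equiv.addRight x₀).subtypeEquiv fun x => by
      rw [Equiv.coe_addRight, map_add, hx₀, ← h01, add_assoc]
      simp [show (1 : ZMod 2) + 1 = 0 by decide])
  rw [← Nat.card_congr (Equiv.sumCompl fun x => f x ≠ 0), Nat.card_sum, ← Nat.card_congr e,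
    mul_two]

/-- The number of normal bases of the field with `2 ^ 2 ^ d` elements. -/
theorem card_normalBases (d : ℕ) : Nat.card (normalBases 2 (2 ^ d)) * 2 ^ d = 2 ^ (2 ^ d - 1) := by
  have hn : 2 ^ d ≠ 0 := by positivity
  rw [← card_normalElements hn,
    Nat.card_congr (Equiv.subtypeEquivRight fun γ => isNormalElement_iff rfl γ)]
  have h := card_ne_zero_mul_two
    (Algebra.trace (ZMod 2) (GaloisField 2 (2 ^ d))).toAddMonoidHom
    (Algebra.trace_surjective (ZMod 2) (GaloisField 2 (2 ^ d)))
  rw [natCard_galoisField hn] at h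
  have h2 : 2 ^ 2 ^ d = 2 ^ (2 ^ d - 1) * 2 := by
    rw [← pow_succ, Nat.sub_add_cancel Nat.one_le_two_pow]
  rw [h2] at h
  exact Nat.eq_of_mul_eq_mul_right two_pos h

end NormalBases

end DeBruijnNecklace

/-! ### Comparison of the three counts. -/

theorem mainTheorem6 (d : ℕ) (hd : 1 ≤ d) :
    Nonempty (DeBruijnNecklace.binaryDeBruijnWords (d + 1) ≃
      DeBruijnNecklace.oddBinaryNecklaces (2 ^ d)) ∧
    Nonempty (DeBruijnNecklace.oddBinaryNecklaces (2 ^ d) ≃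
      DeBruijnNecklace.normalBases 2 (2 ^ d)) ∧
    Nonempty (DeBruijnNecklace.binaryDeBruijnWords (d + 1) ≃
      DeBruijnNecklace.normalBases 2 (2 ^ d)) := by
  have h1 := DeBruijnNecklace.card_binaryDeBruijnWords d
  have h2 := DeBruijnNecklace.card_oddBinaryNecklaces d
  have h3 := DeBruijnNecklace.card_normalBases d
  have hpos : 0 < 2 ^ d := by positivity
  have h4 : 2 ^ 2 ^ d = 2 ^ (2 ^ d - 1) * 2 := by
    rw [← pow_succ, Nat.sub_add_cancel Nat.one_le_two_pow]
  have h12 : Nat.card (DeBruijnNecklace.binaryDeBruijnWords (d + 1)) =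
      Nat.card (DeBruijnNecklace.oddBinaryNecklaces (2 ^ d)) := by
    rw [h4, pow_succ, ← mul_assoc, ← h2] at h1
    exact Nat.eq_of_mul_eq_mul_right hpos (Nat.eq_of_mul_eq_mul_right two_pos h1)
  have h23 : Nat.card (DeBruijnNecklace.oddBinaryNecklaces (2 ^ d)) =
      Nat.card (DeBruijnNecklace.normalBases 2 (2 ^ d)) :=
    Nat.eq_of_mul_eq_mul_right hpos (h2.trans h3.symm)
  -- Equal `Nat.card` yields a bijection only for finite types; the positive products exclude the
  -- value 0 taken on infinite ones.
  have f2 : Finite (DeBruijnNecklace.oddBinaryNecklaces (2 ^ d)) :=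
    Nat.finite_of_card_ne_zero fun h => by
      rw [h, zero_mul] at h2
      exact absurd h2.symm (by positivity)
  have f1 : Finite (DeBruijnNecklace.binaryDeBruijnWords (d + 1)) :=
    Nat.finite_of_card_ne_zero fun h => by
      rw [h, zero_mul] at h1
      exact absurd h1.symm (by positivity)
  have f3 : Finite (DeBruijnNecklace.normalBases 2 (2 ^ d)) :=
    Nat.finite_of_card_ne_zero fun h => by
      rw [h, zero_mul] at h3
      exact absurd h3.symm (by positivity)
  exact ⟨Finite.card_eq.mp h12, Finite.card_eq.mp h23, Finite.card_eq.mp (h12.trans h23)⟩
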